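/- Consider a control system $\dot y=f(y,u)$ a.e., $y(0)=x$, with measurable controls $u$ taking values a.e. in $\mathcal U=[-1,1]^M$, of one of the following two types: (a) linear: $f(x,u)=Ax+Bu$ on $\mathbb R^N$, with $A\in\mathbb R^{N\times N}$ and $B\in\mathbb R^{N\times M}$; (b) planar, control-affine: $f(x,u)=F(x)+\sum_{i=1}^M u_i\,g_i(x)$ on $\mathbb R^2$ ($N=2$), where $F,g_1,\dots,g_M:\mathbb R^2\to\mathbb R^2$ are of class $C^1$ with Lipschitz continuous differentials. Let $T(x)\in[0,+\infty]$ be the minimum time to reach the origin from $x$, i.e. the infimum of the times $t\ge0$ such that, for some control $u$, there is a (Carathéodory) solution on $[0,t]$ that starts at $x$ and is at the origin at time $t$ ($T(x)=+\infty$ if there is none). Set $\mathcal R_t=\{x:T(x)\le t\}$ and $h(x,\zeta)=\min_{u\in\mathcal U}\langle\zeta,f(x,u)\rangle$. For $K\subset\mathbb R^d$ and $x\in K$ let $N_K(x)$ be the set of proximal normals to $K$ at $x$: all $v$ for which there is $\sigma\ge0$ with $\langle v,y-x\rangle\le\sigma\|y-x\|^2$ for all $y\in K$. A locally closed set $K$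 has (locally) positive reach if there is a continuous $\varphi:K\to[0,\infty)$ such that $\langle v,y-x\rangle\le\varphi(x)\|v\|\,\|y-x\|^2$ for all $x,y\in K$ and $v\in N_K(x)$. If $T(x)<+\infty$, let $\partial^\infty T(x)$ be the set of all $v\in\mathbb R^N$ with $(v,0)\in N_{\mathrm{epi}(T)}(x,T(x))$, where $\mathrm{epi}(T)=\{(x,\beta)\in\mathbb R^N\times\mathbb R:\beta\ge T(x)\}$. Let $\bar x\ne0$ with $T(\bar x)<+\infty$, and let $D$ be a neighbourhood of $\bar x$ (for instance a closed ball $\bar B(\bar x,\delta)$, $\delta>0$) such that the epigraph $\{(x,\beta)\in D\times\mathbb R:\beta\ge T(x)\}$ of $T$ restricted to $D$ has positive reach. Then, for every $\zeta\in\mathbb R^N$ with $\zeta\neq0$, $$\zeta\in\partial^\infty T(\bar x)\quad\Longleftrightarrow\quad h(\bar x,\zeta)=0\ \text{ and }\ \zeta\in N_{\mathcal R_{T(\bar x)}}(\bar x).$$ -/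

import Mathlib

open Set MeasureTheory Topology
open scoped NNReal

noncomputable section

namespace MinTime

/-! ### Proximal normals, positive reach, epigraphs -/

section NonsmoothAnalysis

variable {H : Type*} [NormedAddCommGroup H] [InnerProductSpace ℝ H]

/-- The cone `N_K(x)` of proximal normals to `K` at a point `x ∈ K` (empty when `x ∉ K`):
`⟨v, y - x⟩ ≤ σ ‖y - x‖ ^ 2` for all `y ∈ K`, for some `σ ≥ 0` depending on `v` and `x`. -/
def proximalNormals (K : Set H) (x : H) : Set H :=
  {v | x ∈ K ∧ ∃ σ : ℝ, 0 ≤ σ ∧ ∀ y ∈ K, inner ℝ v (y - x) ≤ σ * ‖y - x‖ ^ 2}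

/-- `K` is locally closed and there is a continuous `φ : K → [0, ∞)` with
`⟨v, y - x⟩ ≤ φ(x) ‖v‖ ‖y - x‖ ^ 2` for all `x, y ∈ K` and `v ∈ N_K(x)`. -/
def HasLocallyPositiveReach (K : Set H) : Prop :=
  IsLocallyClosed K ∧
    ∃ φ : H → ℝ, ContinuousOn φ K ∧ (∀ x ∈ K, 0 ≤ φ x) ∧
      ∀ x ∈ K, ∀ y ∈ K, ∀ v ∈ proximalNormals K x,
        inner ℝ v (y - x) ≤ φ x * ‖v‖ * ‖y - x‖ ^ 2

/-- The epigraph `{(x, β) : x ∈ D, β ≥ T(x)}` of the restriction of `T` to `D`, as a subset of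
`H × ℝ` with its Euclidean structure. -/
def epigraphOn (D : Set H) (T : H → EReal) : Set (WithLp 2 (H × ℝ)) :=
  {p | p.fst ∈ D ∧ T p.fst ≤ (p.snd : EReal)}

/-- The horizon subdifferential `∂^∞ T(x)`: all `v` such that `(v, 0)` is a proximal normal to
`epi(T)` at `(x, T(x))`.  It is meant for functions `T` with values in `(-∞, +∞]` and for points
`x` with `T(x) < +∞`. -/
def horizonSubdifferential (T : H → EReal) (x : H) : Set H :=
  {v | WithLp.toLp 2 (v, (0 : ℝ)) ∈
    proximalNormals (epigraphOn univ T) (WithLp.toLp 2 (x, (T x).toReal))}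

end NonsmoothAnalysis

/-! ### Control systems `y' = f(y, u)`, `u ∈ [-1, 1] ^ M` -/

section Control

variable {N M : ℕ}

/-- The control set `[-1, 1] ^ M`. -/
def controlSet (M : ℕ) : Set (Fin M → ℝ) := {w | ∀ i, w i ∈ Icc (-1 : ℝ) 1}

/-- Admissible controls: measurable, with values in `[-1, 1] ^ M` almost everywhere. -/
def IsAdmissible (u : ℝ → Fin M → ℝ) : Prop :=
  Measurable u ∧ ∀ᵐ s : ℝ, u s ∈ controlSet M

/-- `y` is a Carathéodory solution on `[0, t]` of `y' = f(y, u)`, `y(0) = x`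
(in integral form). -/
def IsTrajectory (f : EuclideanSpace ℝ (Fin N) → (Fin M → ℝ) → EuclideanSpace ℝ (Fin N))
    (u : ℝ → Fin M → ℝ) (x : EuclideanSpace ℝ (Fin N)) (t : ℝ)
    (y : ℝ → EuclideanSpace ℝ (Fin N)) : Prop :=
  ContinuousOn y (Icc 0 t) ∧
    IntervalIntegrable (fun r => f (y r) (u r)) volume 0 t ∧
    ∀ s ∈ Icc 0 t, y s = x + ∫ r in (0 : ℝ)..s, f (y r) (u r)

/-- Some admissible control steers `x` to the origin in time `t`. -/
def SteersToOrigin (f : EuclideanSpace ℝ (Fin N) → (Fin M → ℝ) → EuclideanSpace ℝ (Fin N))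
    (x : EuclideanSpace ℝ (Fin N)) (t : ℝ) : Prop :=
  0 ≤ t ∧ ∃ (u : ℝ → Fin M → ℝ) (y : ℝ → EuclideanSpace ℝ (Fin N)),
    IsAdmissible u ∧ IsTrajectory f u x t y ∧ y t = 0

/-- The minimum time `T(x) ∈ [0, +∞]` to reach the origin from `x` (`+∞` if the origin cannot be
reached): the infimum, over all admissible controls, of the times at which the trajectory starting
from `x` is at the origin. -/
def minTime (f : EuclideanSpace ℝ (Fin N) → (Fin M → ℝ) → EuclideanSpace ℝ (Fin N))
    (x : EuclideanSpace ℝ (Fin N)) : EReal :=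
  sInf {τ : EReal | ∃ t : ℝ, SteersToOrigin f x t ∧ τ = (t : EReal)}

/-- The sublevel `R_t = {x : T(x) ≤ t}` of the minimum time function. -/
def reachableSet (f : EuclideanSpace ℝ (Fin N) → (Fin M → ℝ) → EuclideanSpace ℝ (Fin N))
    (t : EReal) : Set (EuclideanSpace ℝ (Fin N)) :=
  {x | minTime f x ≤ t}

/-- The minimized Hamiltonian `h(x, p) = min {⟨p, f(x, w)⟩ : w ∈ [-1, 1] ^ M}`
(for `f` continuous in the control, the infimum is a minimum over a nonempty compact set). -/
def minHamiltonian (f : EuclideanSpace ℝ (Fin N) → (Fin M → ℝ) → EuclideanSpace ℝ (Fin N))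
    (x p : EuclideanSpace ℝ (Fin N)) : ℝ :=
  sInf ((fun w => inner ℝ p (f x w)) '' controlSet M)

/-- The linear dynamics `f(x, u) = A x + B u`. -/
def linearDynamics (A : Matrix (Fin N) (Fin N) ℝ) (B : Matrix (Fin N) (Fin M) ℝ)
    (x : EuclideanSpace ℝ (Fin N)) (w : Fin M → ℝ) : EuclideanSpace ℝ (Fin N) :=
  WithLp.toLp 2 (A.mulVec x.ofLp + B.mulVec w)

/-- The control-affine dynamics `f(x, u) = F(x) + G(x) u = F(x) + ∑ i, u i • g i (x)`, where
the `g i` are the columns of `G`. -/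
def affineDynamics (F : EuclideanSpace ℝ (Fin N) → EuclideanSpace ℝ (Fin N))
    (g : Fin M → EuclideanSpace ℝ (Fin N) → EuclideanSpace ℝ (Fin N))
    (x : EuclideanSpace ℝ (Fin N)) (w : Fin M → ℝ) : EuclideanSpace ℝ (Fin N) :=
  F x + ∑ i, w i • g i x

/-- `F` is of class `C^{1,1}`, with derivative globally Lipschitz with constant `L`. -/
def IsC11 (L : ℝ≥0) (F : EuclideanSpace ℝ (Fin N) → EuclideanSpace ℝ (Fin N)) : Prop :=
  ContDiff ℝ 1 F ∧ LipschitzWith L (fderiv ℝ F)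

end Control

end MinTime

end

/-! Write `r = T(x₀)`. A horizon subgradient `ζ` of `T` at `x₀` is a proximal normal to the
sublevel set `{T ≤ r}`. Going backwards in time from `x₀` with a constant control `w` stays in the
epigraph of `T` if time is added at unit rate, which gives `⟨ζ, -f(x₀, w)⟩ ≤ 0` and hence
`h(x₀, ζ) ≥ 0`. A trajectory from `x₀` reaching the origin before time `r + s` is in `{T ≤ r}` at
time `s`, and the proximal normal inequality at that point gives `h(x₀, ζ) ≤ o(1)` as `s → 0`.

Conversely, if `T(x) < r + s` with `x` close to `x₀`, then a near-optimal trajectory from `x` enters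
`{T ≤ r}` within time `s`, at a point `z` with `‖z - x₀‖ = O(‖x - x₀‖ + s)`. There
`⟨ζ, z - x₀⟩ ≤ σ ‖z - x₀‖²`, while `h(x₀, ζ) ≥ 0` and the Lipschitz bound give
`⟨ζ, z - x⟩ ≥ -O((‖x - x₀‖ + s)²)`; subtracting yields the proximal inequality in the epigraph.
-/

namespace MinTime

open Filter Metric

lemma eventually_mul_lt (c : ℝ) {δ : ℝ} (hδ : 0 < δ) : ∀ᶠ s : ℝ in 𝓝[>] 0, c * s < δ := by
  have hlim : Tendsto (fun s : ℝ => c * s) (𝓝[>] 0) (𝓝 0) := by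
    simpa only [mul_zero] using ((continuous_const_mul c).tendsto 0).mono_left nhdsWithin_le_nhds
  exact hlim.eventually_lt_const hδ

section NonsmoothAnalysis

variable {H : Type*} [NormedAddCommGroup H] [InnerProductSpace ℝ H] {K : Set H} {x v : H}

lemma mem_proximalNormals_iff_eventually :
    v ∈ proximalNormals K x ↔
      x ∈ K ∧ ∃ σ : ℝ, ∀ᶠ y in 𝓝[K] x, inner ℝ v (y - x) ≤ σ * ‖y - x‖ ^ 2 := by
  refine and_congr_right fun _ => ⟨fun ⟨σ, _, hσ⟩ => ⟨σ, eventually_mem_nhdsWithin.mono hσ⟩, ?_⟩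
  rintro ⟨σ, hσ⟩
  obtain ⟨ε, hε, hball⟩ := Metric.mem_nhdsWithin_iff.1 hσ
  refine ⟨|σ| + ‖v‖ / ε, by positivity, fun y hy => ?_⟩
  rw [add_mul]
  rcases lt_or_ge ‖y - x‖ ε with hnear | hfar
  · have hle : inner ℝ v (y - x) ≤ σ * ‖y - x‖ ^ 2 := hball ⟨mem_ball_iff_norm.2 hnear, hy⟩
    have hσ_le : σ * ‖y - x‖ ^ 2 ≤ |σ| * ‖y - x‖ ^ 2 := by gcongr; exact le_abs_self σ
    have : 0 ≤ ‖v‖ / ε * ‖y - x‖ ^ 2 := by positivity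
    linarith
  · have hle : inner ℝ v (y - x) ≤ ‖v‖ / ε * ‖y - x‖ ^ 2 :=
      calc inner ℝ v (y - x) ≤ ‖v‖ * ‖y - x‖ := real_inner_le_norm _ _
        _ = ‖v‖ / ε * (ε * ‖y - x‖) := by field_simp
        _ ≤ ‖v‖ / ε * (‖y - x‖ * ‖y - x‖) := by gcongr
        _ = ‖v‖ / ε * ‖y - x‖ ^ 2 := by ring
    have : 0 ≤ |σ| * ‖y - x‖ ^ 2 := by positivity
    linarith

lemma nonpos_of_mem_proximalNormals (hv : v ∈ proximalNormals K x) {g : ℝ → ℝ} {c C : ℝ}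
    (hg : Tendsto g (𝓝[>] 0) (𝓝 c))
    (h : ∀ᶠ s in 𝓝[>] 0, ∃ y ∈ K, ‖y - x‖ ≤ C * s ∧ s * g s ≤ inner ℝ v (y - x)) : c ≤ 0 := by
  obtain ⟨-, σ, hσ₀, hσ⟩ := hv
  have hlim : Tendsto (fun s : ℝ => σ * C ^ 2 * s) (𝓝[>] 0) (𝓝 0) := by
    simpa only [mul_zero] using
      ((continuous_const_mul (σ * C ^ 2)).tendsto 0).mono_left nhdsWithin_le_nhds
  refine le_of_tendsto_of_tendsto hg hlim ?_
  filter_upwards [h, self_mem_nhdsWithin] with s ⟨y, hyK, hys, hgs⟩ (hs : 0 < s)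
  refine le_of_mul_le_mul_left ?_ hs
  calc s * g s ≤ inner ℝ v (y - x) := hgs
    _ ≤ σ * ‖y - x‖ ^ 2 := hσ y hyK
    _ ≤ σ * (C * s) ^ 2 := by gcongr
    _ = s * (σ * C ^ 2 * s) := by ring

lemma inner_nonpos_of_hasDerivWithinAt (hv : v ∈ proximalNormals K x) {γ : ℝ → H} {γ' : H}
    (hγ : HasDerivWithinAt γ γ' (Ioi 0) 0) (hγ₀ : γ 0 = x) (hK : ∀ᶠ s in 𝓝[>] 0, γ s ∈ K) :
    inner ℝ v γ' ≤ 0 := by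
  have hslope : Tendsto (slope γ 0) (𝓝[>] 0) (𝓝 γ') :=
    (hasDerivWithinAt_iff_tendsto_slope' self_notMem_Ioi).1 hγ
  have hsub : ∀ s, γ s - x = s • slope γ 0 s := fun s => by
    simpa only [sub_zero, vsub_eq_sub, hγ₀] using (sub_smul_slope γ 0 s).symm
  refine nonpos_of_mem_proximalNormals hv (C := ‖γ'‖ + 1) (tendsto_const_nhds.inner hslope) ?_
  filter_upwards [hK, hslope.norm.eventually_lt_const (lt_add_one ‖γ'‖), self_mem_nhdsWithin]
    with s hsK hsC (hs : 0 < s)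
  refine ⟨γ s, hsK, ?_, ?_⟩
  · rw [hsub, norm_smul, Real.norm_of_nonneg hs.le, mul_comm]
    gcongr
  · rw [hsub, real_inner_smul_right]

lemma mem_horizonSubdifferential_iff_eventually {T : H → EReal} {r : ℝ} (hr : T x = r) :
    v ∈ horizonSubdifferential T x ↔ ∃ σ : ℝ, ∀ᶠ p : H × ℝ in 𝓝 (x, r), T p.1 ≤ p.2 →
      inner ℝ v (p.1 - x) ≤ σ * (‖p.1 - x‖ ^ 2 + (p.2 - r) ^ 2) := by
  have hmem : WithLp.toLp 2 (x, r) ∈ epigraphOn univ T := ⟨mem_univ x, hr.le⟩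
  have hnhds := (WithLp.prodContinuousLinearEquiv 2 ℝ H ℝ).symm.toHomeomorph.map_nhds_eq (x, r)
  change map (WithLp.toLp 2) (𝓝 (x, r)) = 𝓝 (WithLp.toLp 2 (x, r)) at hnhds
  simp only [horizonSubdifferential, mem_ofPred_eq, hr, EReal.toReal_coe,
    mem_proximalNormals_iff_eventually, hmem, true_and, eventually_nhdsWithin_iff, ← hnhds,
    eventually_map]
  simp [epigraphOn, WithLp.prod_norm_sq_eq_of_L2, WithLp.prod_inner_apply]

lemma mem_proximalNormals_sublevel_of_mem_horizonSubdifferential {T : H → EReal} {r : ℝ}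
    (hr : T x = r) (hv : v ∈ horizonSubdifferential T x) :
    v ∈ proximalNormals {y | T y ≤ r} x := by
  rw [horizonSubdifferential, mem_ofPred_eq, hr, EReal.toReal_coe] at hv
  obtain ⟨-, σ, hσ₀, hσ⟩ := hv
  refine ⟨hr.le, σ, hσ₀, fun y hy => ?_⟩
  simpa [WithLp.prod_norm_sq_eq_of_L2, WithLp.prod_inner_apply] using
    hσ (WithLp.toLp 2 (y, r)) ⟨mem_univ y, hy⟩

lemma inner_nonpos_of_mem_horizonSubdifferential {T : H → EReal} {r : ℝ} (hr : T x = r)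
    (hv : v ∈ horizonSubdifferential T x) {γ : ℝ → H} {γ' : H}
    (hγ : HasDerivWithinAt γ γ' (Ioi 0) 0) (hγ₀ : γ 0 = x) {β : ℝ → ℝ} {β' : ℝ}
    (hβ : HasDerivWithinAt β β' (Ioi 0) 0) (hβ₀ : β 0 = r) (hT : ∀ᶠ s in 𝓝[>] 0, T (γ s) ≤ β s) :
    inner ℝ v γ' ≤ 0 := by
  rw [horizonSubdifferential, mem_ofPred_eq, hr, EReal.toReal_coe] at hv
  have hlift : HasDerivWithinAt (fun s => WithLp.toLp 2 (γ s, β s)) (WithLp.toLp 2 (γ', β'))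
      (Ioi 0) 0 :=
    (WithLp.prodContinuousLinearEquiv 2 ℝ H ℝ).symm.hasFDerivAt.comp_hasDerivWithinAt 0
      (hγ.prodMk hβ)
  simpa [WithLp.prod_inner_apply] using inner_nonpos_of_hasDerivWithinAt hv hlift
    (by rw [hγ₀, hβ₀]) (hT.mono fun s hs => ⟨mem_univ _, hs⟩)

end NonsmoothAnalysis

section Concat

/-- Concatenation of functions of time: follow `v₁` up to time `s` and then `v₂`, whose clock starts
at time `s`. It is used for controls, for trajectories and for their velocities. -/
noncomputable def concat {α : Type*} (s : ℝ) (v₁ v₂ : ℝ → α) (r : ℝ) : α :=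
  if r ≤ s then v₁ r else v₂ (r - s)

variable {α β ι E : Type*} [NormedAddCommGroup E] {s t r : ℝ}

lemma concat_of_le (v₁ v₂ : ℝ → α) (h : r ≤ s) : concat s v₁ v₂ r = v₁ r := if_pos h

lemma concat_of_lt (v₁ v₂ : ℝ → α) (h : s < r) : concat s v₁ v₂ r = v₂ (r - s) := if_neg h.not_ge

lemma map₂_concat (φ : α → β → ι) (v₁ v₂ : ℝ → α) (w₁ w₂ : ℝ → β) (r : ℝ) :
    φ (concat s v₁ v₂ r) (concat s w₁ w₂ r) =
      concat s (fun q => φ (v₁ q) (w₁ q)) (fun q => φ (v₂ q) (w₂ q)) r := by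
  unfold concat; split_ifs <;> rfl

variable {v₁ v₂ : ℝ → E}

lemma intervalIntegrable_concat (hs : 0 ≤ s) (ht : 0 ≤ t) (h₁ : IntervalIntegrable v₁ volume 0 s)
    (h₂ : IntervalIntegrable v₂ volume 0 t) :
    IntervalIntegrable (concat s v₁ v₂) volume 0 (s + t) := by
  have h₂' : IntervalIntegrable (fun r => v₂ (r - s)) volume s (s + t) := by
    simpa only [zero_add, add_comm t] using h₂.comp_sub_right s
  refine (h₁.congr fun r hr => ?_).trans (h₂'.congr fun r hr => ?_)
  · rw [uIoc_of_le hs] at hr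
    exact (concat_of_le v₁ v₂ hr.2).symm
  · rw [uIoc_of_le (by linarith)] at hr
    exact (concat_of_lt v₁ v₂ hr.1).symm

variable [NormedSpace ℝ E]

lemma integral_concat_of_le (hr : 0 ≤ r) (hrs : r ≤ s) :
    ∫ q in 0..r, concat s v₁ v₂ q = ∫ q in 0..r, v₁ q :=
  intervalIntegral.integral_congr fun _ hq =>
    concat_of_le v₁ v₂ ((uIcc_of_le hr ▸ hq).2.trans hrs)

lemma integral_concat_of_ge (hs : 0 ≤ s) (hsr : s ≤ r) (h₁ : IntervalIntegrable v₁ volume 0 s)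
    (h₂ : IntervalIntegrable v₂ volume 0 (r - s)) :
    ∫ q in 0..r, concat s v₁ v₂ q = (∫ q in 0..s, v₁ q) + ∫ q in 0..(r - s), v₂ q := by
  have hint : IntervalIntegrable (concat s v₁ v₂) volume 0 r := by
    simpa only [add_sub_cancel] using intervalIntegrable_concat hs (sub_nonneg.2 hsr) h₁ h₂
  have htail : ∫ q in s..r, concat s v₁ v₂ q = ∫ q in s..r, v₂ (q - s) :=
    intervalIntegral.integral_congr_ae (.of_forall fun q hq =>
      concat_of_lt v₁ v₂ (uIoc_of_le hsr ▸ hq).1)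
  have hs_mem : s ∈ uIcc 0 r := by rw [uIcc_of_le (hs.trans hsr)]; exact ⟨hs, hsr⟩
  rw [← intervalIntegral.integral_add_adjacent_intervals
      (hint.mono_set (uIcc_subset_uIcc left_mem_uIcc hs_mem))
      (hint.mono_set (uIcc_subset_uIcc hs_mem right_mem_uIcc)),
    integral_concat_of_le hs le_rfl, htail, intervalIntegral.integral_comp_sub_right, sub_self]

end Concat

section Estimates

variable {E : Type*} [NormedAddCommGroup E] [NormedSpace ℝ E]

lemma norm_sub_le_mul_of_norm_sub_lt {y v : ℝ → E} {s ρ : ℝ} {C : ℝ≥0}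
    (hy : ContinuousOn y (Icc 0 s))
    (hyv : ∀ a ∈ Icc 0 s, ∀ b ∈ Icc 0 s, y b - y a = ∫ r in a..b, v r)
    (hv : ∀ᵐ r, r ∈ Icc 0 s → ‖y r - y 0‖ < ρ → ‖v r‖ ≤ C) (hρ : C * s < ρ) :
    ∀ r ∈ Icc 0 s, ‖y r - y 0‖ ≤ C * r := by
  -- The bound propagates: as long as it holds, `y` stays at distance `< ρ` from `y 0`, and so it
  -- does for a little longer, with speed at most `C`.
  refine IsClosed.Icc_subset_of_forall_mem_nhdsWithin (s := {r | ‖y r - y 0‖ ≤ C * r}) ?_ ?_ ?_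
  · rw [inter_comm]
    exact isClosed_Icc.isClosed_le (hy.sub continuousOn_const).norm
      (continuousOn_const.mul continuousOn_id)
  · simp only [mem_ofPred_eq, sub_self, norm_zero, mul_zero, le_refl]
  rintro r ⟨hr : ‖y r - y 0‖ ≤ C * r, hr₀, hrs⟩
  have hlt : ‖y r - y 0‖ < ρ := hr.trans_lt ((by gcongr : (C : ℝ) * r ≤ C * s).trans_lt hρ)
  have hcont : ContinuousWithinAt y (Ici r) r :=
    ((hy r ⟨hr₀, hrs.le⟩).mono (Icc_subset_Icc_left hr₀)).mono_of_mem_nhdsWithin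
      (Icc_mem_nhdsGE hrs)
  obtain ⟨c, hrc, hc⟩ := mem_nhdsGE_iff_exists_Ico_subset.1
    ((hcont.sub continuousWithinAt_const).norm.eventually_lt continuousWithinAt_const hlt)
  filter_upwards [Ioo_mem_nhdsGT (lt_min hrc hrs)] with b ⟨hrb, hb⟩
  have hbs : b ≤ s := hb.le.trans (min_le_right _ _)
  have hstep : ‖y b - y r‖ ≤ C * (b - r) := by
    rw [hyv r ⟨hr₀, hrs.le⟩ b ⟨hr₀.trans hrb.le, hbs⟩, ← abs_of_pos (sub_pos.2 hrb)]
    refine intervalIntegral.norm_integral_le_of_norm_le_const_ae ?_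
    filter_upwards [hv] with q hq hqr
    rw [uIoc_of_le hrb.le] at hqr
    exact hq ⟨hr₀.trans hqr.1.le, hqr.2.trans hbs⟩
      (hc ⟨hqr.1.le, hqr.2.trans_lt (hb.trans_le (min_le_left _ _))⟩)
  calc ‖y b - y 0‖ ≤ ‖y b - y r‖ + ‖y r - y 0‖ := norm_sub_le_norm_sub_add_norm_sub _ _ _
    _ ≤ C * (b - r) + C * r := add_le_add hstep hr
    _ = C * b := by ring

lemma mul_le_inner_integral {H : Type*} [NormedAddCommGroup H] [InnerProductSpace ℝ H]
    [CompleteSpace H] {ζ : H} {v : ℝ → H} {a b c : ℝ} (hab : a ≤ b)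
    (hv : IntervalIntegrable v volume a b) (hc : ∀ᵐ r, r ∈ Icc a b → c ≤ inner ℝ ζ (v r)) :
    (b - a) * c ≤ inner ℝ ζ (∫ r in a..b, v r) := by
  have hint : IntervalIntegrable (fun r => inner ℝ ζ (v r)) volume a b :=
    ⟨(innerSL ℝ ζ).integrable_comp hv.1, (innerSL ℝ ζ).integrable_comp hv.2⟩
  calc (b - a) * c = ∫ _ in a..b, c := by
        rw [intervalIntegral.integral_const, smul_eq_mul]
    _ ≤ ∫ r in a..b, inner ℝ ζ (v r) := intervalIntegral.integral_mono_ae_restrict hab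
        intervalIntegrable_const hint ((ae_restrict_iff' measurableSet_Icc).2 hc)
    _ = inner ℝ ζ (∫ r in a..b, v r) := (innerSL ℝ ζ).intervalIntegral_comp_comm hv

lemma exists_hasDerivWithinAt_of_lipschitzOnWith [CompleteSpace E] {F : E → E} {x₀ : E} {δ : ℝ}
    {K : ℝ≥0} (hδ : 0 < δ) (hF : LipschitzOnWith K F (closedBall x₀ δ)) :
    ∃ ε > 0, ∃ γ : ℝ → E, γ 0 = x₀ ∧
      ∀ t ∈ Icc 0 ε, γ t ∈ closedBall x₀ δ ∧ HasDerivWithinAt γ (F (γ t)) (Icc 0 ε) t := by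
  lift δ to ℝ≥0 using hδ.le
  set L : ℝ≥0 := ‖F x₀‖₊ + K * δ + 1 with hL
  have hF_le : ∀ x ∈ closedBall x₀ δ, ‖F x‖ ≤ L := fun x hx => by
    have hsub := hF.norm_sub_le hx (mem_closedBall_self hδ.le)
    have hx' : K * ‖x - x₀‖ ≤ K * (δ : ℝ) := by
      gcongr; exact mem_closedBall_iff_norm.1 hx
    have := norm_le_norm_add_norm_sub' (F x) (F x₀)
    push_cast [hL, coe_nnnorm]
    linarith
  have hε : 0 < (δ : ℝ) / L := by positivity
  have hpl : IsPicardLindelof (fun _ => F) (⟨0, le_rfl, hε.le⟩ : Icc 0 ((δ : ℝ) / L))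
      x₀ δ 0 L K := by
    refine .of_time_independent hF_le hF ?_
    simp only [sub_zero, sub_self, max_eq_left hε.le, NNReal.coe_zero]
    exact (mul_div_cancel₀ _ (by positivity)).le
  obtain ⟨γ, hγ₀, hγ⟩ := hpl.exists_eq_forall_mem_Icc_hasDerivWithinAt₀
  have hball : ∀ᶠ t in 𝓝[≥] 0, γ t ∈ closedBall x₀ δ := by
    have hcont : ContinuousWithinAt γ (Ici 0) 0 :=
      (hγ 0 ⟨le_rfl, hε.le⟩).continuousWithinAt.mono_of_mem_nhdsWithin (Icc_mem_nhdsGE hε)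
    exact hcont (hγ₀ ▸ closedBall_mem_nhds x₀ hδ)
  obtain ⟨ε', hε', hsub⟩ := mem_nhdsGE_iff_exists_Icc_subset.1 hball
  have hle : Icc 0 (min ε' (δ / L)) ⊆ Icc 0 (δ / L : ℝ) := Icc_subset_Icc_right (min_le_right _ _)
  exact ⟨min ε' (δ / L), lt_min hε' hε, γ, hγ₀, fun t ht =>
    ⟨hsub ⟨ht.1, ht.2.trans (min_le_left _ _)⟩, (hγ t (hle ht)).mono hle⟩⟩

end Estimates

section Control

variable {N M : ℕ} {f : EuclideanSpace ℝ (Fin N) → (Fin M → ℝ) → EuclideanSpace ℝ (Fin N)}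
  {u : ℝ → Fin M → ℝ} {x : EuclideanSpace ℝ (Fin N)} {s t : ℝ} {y : ℝ → EuclideanSpace ℝ (Fin N)}

namespace IsAdmissible

lemma shift (hu : IsAdmissible u) (s : ℝ) : IsAdmissible fun r => u (r + s) :=
  ⟨hu.1.comp (measurable_add_const s),
    (measurePreserving_add_right volume s).quasiMeasurePreserving.ae hu.2⟩

lemma concat {u₁ u₂ : ℝ → Fin M → ℝ} (h₁ : IsAdmissible u₁) (h₂ : IsAdmissible u₂) (s : ℝ) :
    IsAdmissible (concat s u₁ u₂) := by
  refine ⟨Measurable.ite measurableSet_Iic h₁.1 (h₂.1.comp (measurable_sub_const s)), ?_⟩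
  filter_upwards [h₁.2, (measurePreserving_sub_right volume s).quasiMeasurePreserving.ae h₂.2]
    with r h₁r h₂r
  rcases le_or_gt r s with hrs | hsr
  · rwa [concat_of_le _ _ hrs]
  · rwa [concat_of_lt _ _ hsr]

end IsAdmissible

namespace IsTrajectory

lemma apply_zero (h : IsTrajectory f u x t y) (ht : 0 ≤ t) : y 0 = x := by
  simpa only [intervalIntegral.integral_same, add_zero] using h.2.2 0 ⟨le_rfl, ht⟩

lemma intervalIntegrable_sub (h : IsTrajectory f u x t y) {a b : ℝ} (ha : a ∈ Icc 0 t)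
    (hb : b ∈ Icc 0 t) : IntervalIntegrable (fun r => f (y r) (u r)) volume a b := by
  refine h.2.1.mono_set ?_
  rw [uIcc_of_le (ha.1.trans ha.2)]
  exact uIcc_subset_Icc ha hb

lemma sub_eq_integral (h : IsTrajectory f u x t y) {a b : ℝ} (ha : a ∈ Icc 0 t)
    (hb : b ∈ Icc 0 t) : y b - y a = ∫ r in a..b, f (y r) (u r) := by
  have h0 : (0 : ℝ) ∈ Icc 0 t := ⟨le_rfl, ha.1.trans ha.2⟩
  rw [h.2.2 b hb, h.2.2 a ha, add_sub_add_left_eq_sub]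
  exact intervalIntegral.integral_interval_sub_left (h.intervalIntegrable_sub h0 hb)
    (h.intervalIntegrable_sub h0 ha)

lemma of_integral_eq (ht : 0 ≤ t) (hi : IntervalIntegrable (fun r => f (y r) (u r)) volume 0 t)
    (h : ∀ s ∈ Icc 0 t, y s = x + ∫ r in (0 : ℝ)..s, f (y r) (u r)) : IsTrajectory f u x t y := by
  have hprim := intervalIntegral.continuousOn_primitive_interval' hi left_mem_uIcc
  rw [uIcc_of_le ht] at hprim
  exact ⟨(continuousOn_const.add hprim).congr h, hi, h⟩

lemma of_hasDerivAt (hy : ContinuousOn y (Icc 0 t))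
    (hy' : ∀ s ∈ Ioo 0 t, HasDerivAt y (f (y s) (u s)) s)
    (hi : IntervalIntegrable (fun r => f (y r) (u r)) volume 0 t) :
    IsTrajectory f u (y 0) t y := by
  refine ⟨hy, hi, fun s hs => ?_⟩
  have hi_s : IntervalIntegrable (fun r => f (y r) (u r)) volume 0 s :=
    hi.mono_set (uIcc_subset_uIcc left_mem_uIcc (by rwa [uIcc_of_le (hs.1.trans hs.2)]))
  rw [intervalIntegral.integral_eq_sub_of_hasDerivAt_of_le hs.1
    (hy.mono (Icc_subset_Icc_right hs.2)) (fun r hr => hy' r ⟨hr.1, hr.2.trans_le hs.2⟩) hi_s,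
    add_sub_cancel]

lemma shift (h : IsTrajectory f u x t y) (hs : s ∈ Icc 0 t) :
    IsTrajectory f (fun r => u (r + s)) (y s) (t - s) (fun r => y (r + s)) := by
  refine of_integral_eq (sub_nonneg.2 hs.2) ?_ fun r hr => ?_
  · simpa only [sub_self] using
      (h.intervalIntegrable_sub hs ⟨hs.1.trans hs.2, le_rfl⟩).comp_add_right s
  · rw [intervalIntegral.integral_comp_add_right (fun r => f (y r) (u r)) s, zero_add,
      ← h.sub_eq_integral hs ⟨add_nonneg hr.1 hs.1, le_sub_iff_add_le.1 hr.2⟩, add_sub_cancel]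

lemma concat {u₁ u₂ : ℝ → Fin M → ℝ} {y₁ y₂ : ℝ → EuclideanSpace ℝ (Fin N)} (hs : 0 ≤ s)
    (ht : 0 ≤ t) (h₁ : IsTrajectory f u₁ x s y₁) (h₂ : IsTrajectory f u₂ (y₁ s) t y₂) :
    IsTrajectory f (concat s u₁ u₂) x (s + t) (concat s y₁ y₂) := by
  refine of_integral_eq (add_nonneg hs ht) ?_ fun r hr => ?_
  · simp only [map₂_concat]
    exact intervalIntegrable_concat hs ht h₁.2.1 h₂.2.1
  · simp only [map₂_concat]
    rcases le_or_gt r s with hrs | hsr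
    · rw [concat_of_le _ _ hrs, integral_concat_of_le hr.1 hrs, h₁.2.2 r ⟨hr.1, hrs⟩]
    · have hr_mem : r - s ∈ Icc 0 t := ⟨sub_nonneg.2 hsr.le, sub_le_iff_le_add'.2 hr.2⟩
      rw [concat_of_lt _ _ hsr, integral_concat_of_ge hs hsr.le h₁.2.1
          (h₂.intervalIntegrable_sub ⟨le_rfl, ht⟩ hr_mem),
        h₂.2.2 _ hr_mem, h₁.2.2 s ⟨hs, le_rfl⟩, add_assoc]

lemma steersToOrigin (h : IsTrajectory f u x t y) (hu : IsAdmissible u) (hy : y t = 0)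
    (hs : s ∈ Icc 0 t) : SteersToOrigin f (y s) (t - s) :=
  ⟨sub_nonneg.2 hs.2, _, _, hu.shift s, h.shift hs, by rwa [sub_add_cancel]⟩

end IsTrajectory

lemma SteersToOrigin.prepend (h₂ : SteersToOrigin f (y s) t) (hs : 0 ≤ s) (hu : IsAdmissible u)
    (h₁ : IsTrajectory f u x s y) : SteersToOrigin f x (s + t) := by
  obtain ⟨ht, u₂, y₂, hu₂, hy₂, hy₂t⟩ := h₂
  refine ⟨add_nonneg hs ht, _, _, hu.concat hu₂ s, h₁.concat hs ht hy₂, ?_⟩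
  rcases ht.eq_or_lt with rfl | ht
  · rw [add_zero, concat_of_le _ _ le_rfl, ← hy₂.apply_zero le_rfl, hy₂t]
  · rw [concat_of_lt _ _ (lt_add_of_pos_right s ht), add_sub_cancel_left, hy₂t]

lemma minTime_nonneg (x : EuclideanSpace ℝ (Fin N)) : 0 ≤ minTime f x := by
  refine le_sInf ?_
  rintro _ ⟨t, ht, rfl⟩
  exact_mod_cast ht.1

lemma minTime_le_of_steersToOrigin (h : SteersToOrigin f x t) : minTime f x ≤ t :=
  sInf_le ⟨t, h, rfl⟩

lemma exists_steersToOrigin_lt {c : ℝ} (h : minTime f x < c) :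
    ∃ t < c, SteersToOrigin f x t := by
  obtain ⟨_, ⟨t, ht, rfl⟩, htc⟩ := sInf_lt_iff.1 h
  exact ⟨t, by exact_mod_cast htc, ht⟩

lemma coe_toReal_minTime (h : minTime f x < ⊤) : ((minTime f x).toReal : EReal) = minTime f x :=
  EReal.coe_toReal h.ne (EReal.bot_lt_zero.trans_le (minTime_nonneg x)).ne'

namespace IsTrajectory

lemma minTime_le_add (h : IsTrajectory f u x s y) (hs : 0 ≤ s) (hu : IsAdmissible u) :
    minTime f x ≤ minTime f (y s) + s := by
  rw [← EReal.sub_le_iff_le_add (.inl (EReal.coe_ne_bot s)) (.inl (EReal.coe_ne_top s))]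
  refine le_sInf ?_
  rintro _ ⟨t, ht, rfl⟩
  rw [EReal.sub_le_iff_le_add (.inl (EReal.coe_ne_bot s)) (.inl (EReal.coe_ne_top s)), add_comm]
  exact_mod_cast minTime_le_of_steersToOrigin (ht.prepend hs hu h)

lemma minTime_le_sub (h : IsTrajectory f u x t y) (hu : IsAdmissible u) (hy : y t = 0)
    (hs : s ∈ Icc 0 t) : minTime f (y s) ≤ (t - s : ℝ) :=
  minTime_le_of_steersToOrigin (h.steersToOrigin hu hy hs)

end IsTrajectory

/-- The standing assumption on the dynamics near `x₀`: on the closed ball of radius `δ` about `x₀`,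
the vector fields `f(·, w)`, `w ∈ [-1, 1] ^ M`, are bounded by `C` and Lipschitz with constant `K`,
both constants being independent of `w`. -/
structure UniformlyLipschitzNear
    (f : EuclideanSpace ℝ (Fin N) → (Fin M → ℝ) → EuclideanSpace ℝ (Fin N))
    (x₀ : EuclideanSpace ℝ (Fin N)) (δ : ℝ) (C K : ℝ≥0) : Prop where
  radius_pos : 0 < δ
  norm_le : ∀ w ∈ controlSet M, ∀ x ∈ closedBall x₀ δ, ‖f x w‖ ≤ C
  lipschitzOnWith : ∀ w ∈ controlSet M, LipschitzOnWith K (fun x => f x w) (closedBall x₀ δ)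

lemma controlSet_eq_pi : controlSet M = univ.pi fun _ => Icc (-1) 1 := by
  ext w; simp only [controlSet, mem_ofPred_eq, mem_univ_pi]

lemma controlSet_nonempty : (controlSet M).Nonempty :=
  controlSet_eq_pi ▸ univ_pi_nonempty_iff.2 fun _ => nonempty_Icc.2 (by norm_num)

lemma isCompact_controlSet : IsCompact (controlSet M) :=
  controlSet_eq_pi ▸ isCompact_univ_pi fun _ => isCompact_Icc

lemma exists_uniformlyLipschitzNear (hf : LocallyLipschitz (Function.uncurry f))
    (x₀ : EuclideanSpace ℝ (Fin N)) {δ : ℝ} (hδ : 0 < δ) :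
    ∃ C K, UniformlyLipschitzNear f x₀ δ C K := by
  have hcompact := (isCompact_closedBall x₀ δ).prod (isCompact_controlSet (M := M))
  obtain ⟨C, hC⟩ := hcompact.exists_bound_of_continuousOn hf.continuous.continuousOn
  obtain ⟨K, hK⟩ := hf.locallyLipschitzOn.exists_lipschitzOnWith_of_compact hcompact
  refine ⟨C.toNNReal, K, hδ, fun w hw x hx => ?_, fun w hw => ?_⟩
  · exact (hC (x, w) ⟨hx, hw⟩).trans (Real.le_coe_toNNReal C)
  · have hcomp := hK.comp (LipschitzWith.prodMk_right w).lipschitzOnWith fun x hx => ⟨hx, hw⟩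
    rwa [mul_one] at hcomp

variable {x₀ ζ : EuclideanSpace ℝ (Fin N)} {δ : ℝ} {C K : ℝ≥0}

namespace UniformlyLipschitzNear

lemma minHamiltonian_le (hf : UniformlyLipschitzNear f x₀ δ C K) {w : Fin M → ℝ}
    (hw : w ∈ controlSet M) : minHamiltonian f x₀ ζ ≤ inner ℝ ζ (f x₀ w) := by
  refine csInf_le ⟨-(‖ζ‖ * C), ?_⟩ ⟨w, hw, rfl⟩
  rintro _ ⟨w', hw', rfl⟩
  refine (neg_le_neg ?_).trans (neg_le_of_abs_le (abs_real_inner_le_norm ζ (f x₀ w')))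
  gcongr
  exact hf.norm_le w' hw' x₀ (mem_closedBall_self hf.radius_pos.le)

lemma minHamiltonian_sub_le (hf : UniformlyLipschitzNear f x₀ δ C K) (hx : x ∈ closedBall x₀ δ)
    {w : Fin M → ℝ} (hw : w ∈ controlSet M) :
    minHamiltonian f x₀ ζ - K * ‖ζ‖ * ‖x - x₀‖ ≤ inner ℝ ζ (f x w) := by
  have hlip := (hf.lipschitzOnWith w hw).norm_sub_le hx (mem_closedBall_self hf.radius_pos.le)
  have hinner : inner ℝ ζ (f x₀ w - f x w) ≤ ‖ζ‖ * (K * ‖x - x₀‖) := by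
    refine (real_inner_le_norm _ _).trans ?_
    rw [norm_sub_rev]
    gcongr
  rw [inner_sub_right] at hinner
  linarith [hf.minHamiltonian_le (ζ := ζ) hw]

lemma norm_sub_le (hf : UniformlyLipschitzNear f x₀ δ C K) (hu : IsAdmissible u)
    (h : IsTrajectory f u x t y) (hs : s ∈ Icc 0 t) (hδ : ‖x - x₀‖ + C * s < δ) :
    ∀ r ∈ Icc 0 s, ‖y r - x‖ ≤ C * r := by
  have hst : Icc 0 s ⊆ Icc 0 t := Icc_subset_Icc_right hs.2
  have hy₀ : y 0 = x := h.apply_zero (hs.1.trans hs.2)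
  rw [← hy₀] at hδ ⊢
  refine norm_sub_le_mul_of_norm_sub_lt (ρ := δ - ‖y 0 - x₀‖) (h.1.mono hst)
    (fun a ha b hb => h.sub_eq_integral (hst ha) (hst hb)) ?_ (lt_sub_iff_add_lt'.2 hδ)
  filter_upwards [hu.2] with r hur _ hr
  refine hf.norm_le _ hur _ (mem_closedBall_iff_norm.2 ?_)
  linarith [norm_sub_le_norm_sub_add_norm_sub (y r) (y 0) x₀]

lemma le_inner_sub (hf : UniformlyLipschitzNear f x₀ δ C K) (hu : IsAdmissible u)
    (h : IsTrajectory f u x t y) (hs : s ∈ Icc 0 t) (hδ : ‖x - x₀‖ + C * s < δ) :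
    s * (minHamiltonian f x₀ ζ - K * ‖ζ‖ * (‖x - x₀‖ + C * s)) ≤ inner ℝ ζ (y s - x) := by
  have h₀ : (0 : ℝ) ∈ Icc 0 t := ⟨le_rfl, hs.1.trans hs.2⟩
  have hdist : ∀ r ∈ Icc 0 s, ‖y r - x₀‖ ≤ ‖x - x₀‖ + C * s := fun r hr => by
    have hr_le : C * r ≤ C * s := by gcongr; exact hr.2
    linarith [norm_sub_le_norm_sub_add_norm_sub (y r) x x₀, hf.norm_sub_le hu h hs hδ r hr]
  rw [h.2.2 s hs, add_sub_cancel_left]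
  nth_rewrite 1 [← sub_zero s]
  refine mul_le_inner_integral hs.1 (h.intervalIntegrable_sub h₀ hs) ?_
  filter_upwards [hu.2] with r hur hr
  have hball : y r ∈ closedBall x₀ δ := mem_closedBall_iff_norm.2 ((hdist r hr).trans hδ.le)
  refine le_trans ?_ (hf.minHamiltonian_sub_le hball hur)
  gcongr
  exact hdist r hr

lemma minTime_pos (hf : UniformlyLipschitzNear f x₀ δ C K) (hx₀ : x₀ ≠ 0) :
    0 < minTime f x₀ := by
  obtain ⟨τ, hτδ, hτx, hτ : 0 < τ⟩ := ((eventually_mul_lt C hf.radius_pos).and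
    ((eventually_mul_lt C (norm_pos_iff.2 hx₀)).and self_mem_nhdsWithin)).exists
  refine (EReal.coe_pos.2 hτ).trans_le (le_sInf ?_)
  rintro _ ⟨t, ⟨ht, u, y, hu, hy, hyt⟩, rfl⟩
  by_contra! htτ
  have hle : C * t ≤ C * τ := by gcongr; exact_mod_cast htτ.le
  have hdist : ‖y t - x₀‖ ≤ C * t := hf.norm_sub_le hu hy ⟨ht, le_rfl⟩
    (by rw [sub_self, norm_zero, zero_add]; exact hle.trans_lt hτδ) t ⟨ht, le_rfl⟩
  rw [hyt, zero_sub, norm_neg] at hdist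
  linarith

lemma exists_backward_trajectory (hf : UniformlyLipschitzNear f x₀ δ C K) {w : Fin M → ℝ}
    (hw : w ∈ controlSet M) :
    ∃ η : ℝ → EuclideanSpace ℝ (Fin N), η 0 = x₀ ∧ HasDerivWithinAt η (-f x₀ w) (Ioi 0) 0 ∧
      ∀ᶠ s in 𝓝[>] 0, IsTrajectory f (fun _ => w) (η s) s fun q => η (s - q) := by
  obtain ⟨ε, hε, η, hη₀, hη⟩ := exists_hasDerivWithinAt_of_lipschitzOnWith hf.radius_pos
    (hf.lipschitzOnWith w hw).neg
  have hηc : ContinuousOn η (Icc 0 ε) := fun q hq => (hη q hq).2.continuousWithinAt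
  have hfc : ContinuousOn (fun q => f (η q) w) (Icc 0 ε) :=
    (hf.lipschitzOnWith w hw).continuousOn.comp hηc fun q hq => (hη q hq).1
  refine ⟨η, hη₀, ?_, ?_⟩
  · have hder := (hη 0 ⟨le_rfl, hε.le⟩).2.mono_of_mem_nhdsWithin (Icc_mem_nhdsGT hε)
    rwa [hη₀] at hder
  filter_upwards [Ioo_mem_nhdsGT hε] with s ⟨hs, hsε⟩
  have hmaps : MapsTo (fun q => s - q) (Icc 0 s) (Icc 0 ε) := fun q hq =>
    ⟨sub_nonneg.2 hq.2, by linarith [hq.1]⟩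
  have hrev : ContinuousOn (fun q => s - q) (Icc 0 s) := (continuous_sub_left s).continuousOn
  have htraj : IsTrajectory f (fun _ => w) (η (s - 0)) s fun q => η (s - q) := by
    refine IsTrajectory.of_hasDerivAt (y := fun q => η (s - q)) (hηc.comp hrev hmaps)
      (fun q hq => ?_) ?_
    · have hsq : s - q ∈ Ioo 0 ε := ⟨sub_pos.2 hq.2, by linarith [hq.1]⟩
      have hder : HasDerivAt η (-f (η (s - q)) w) (s - q) :=
        (hη _ (Ioo_subset_Icc_self hsq)).2.hasDerivAt (Icc_mem_nhds hsq.1 hsq.2)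
      simpa only [neg_neg] using hder.comp_const_sub s q
    · exact ((hfc.comp hrev hmaps).mono (uIcc_of_le hs.le).subset).intervalIntegrable
  rwa [sub_zero] at htraj

lemma minHamiltonian_nonneg (hf : UniformlyLipschitzNear f x₀ δ C K) (hT : minTime f x₀ < ⊤)
    (hζ : ζ ∈ horizonSubdifferential (minTime f) x₀) : 0 ≤ minHamiltonian f x₀ ζ := by
  obtain ⟨r, hr⟩ : ∃ r : ℝ, minTime f x₀ = r := ⟨_, (coe_toReal_minTime hT).symm⟩
  refine le_csInf (controlSet_nonempty.image _) ?_
  rintro _ ⟨w, hw, rfl⟩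
  obtain ⟨η, hη₀, hη', hη⟩ := hf.exists_backward_trajectory hw
  have hw_adm : IsAdmissible fun _ => w := ⟨measurable_const, .of_forall fun _ => hw⟩
  have hback : ∀ᶠ s in 𝓝[>] 0, minTime f (η s) ≤ (r + s : ℝ) := by
    filter_upwards [hη, self_mem_nhdsWithin] with s hs (hs₀ : 0 < s)
    have hle := hs.minTime_le_add hs₀.le hw_adm
    simp only [sub_self, hη₀, hr] at hle
    exact_mod_cast hle
  have hinner : inner ℝ ζ (-f x₀ w) ≤ 0 :=
    inner_nonpos_of_mem_horizonSubdifferential hr hζ hη' hη₀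
      ((hasDerivWithinAt_id 0 _).const_add r) (add_zero r) hback
  rwa [inner_neg_right, neg_nonpos] at hinner

lemma minHamiltonian_nonpos (hf : UniformlyLipschitzNear f x₀ δ C K) (hx₀ : x₀ ≠ 0)
    (hT : minTime f x₀ < ⊤) (hζ : ζ ∈ proximalNormals (reachableSet f (minTime f x₀)) x₀) :
    minHamiltonian f x₀ ζ ≤ 0 := by
  obtain ⟨r, hr⟩ : ∃ r : ℝ, minTime f x₀ = r := ⟨_, (coe_toReal_minTime hT).symm⟩
  have hr₀ : 0 < r := by exact_mod_cast hr ▸ hf.minTime_pos hx₀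
  have hlim : Tendsto (fun s : ℝ => minHamiltonian f x₀ ζ - K * ‖ζ‖ * (C * s)) (𝓝[>] 0)
      (𝓝 (minHamiltonian f x₀ ζ)) :=
    ((by fun_prop : Continuous fun s : ℝ => minHamiltonian f x₀ ζ - K * ‖ζ‖ * (C * s)).tendsto' 0 _
      (by simp only [mul_zero, sub_zero])).mono_left nhdsWithin_le_nhds
  refine nonpos_of_mem_proximalNormals hζ (C := C) hlim ?_
  filter_upwards [eventually_mul_lt C hf.radius_pos, Ioo_mem_nhdsGT hr₀] with s hsδ ⟨hs₀, hsr⟩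
  obtain ⟨t, hts, ht⟩ := exists_steersToOrigin_lt (f := f) (x := x₀) (c := r + s)
    (by rw [hr]; exact_mod_cast lt_add_of_pos_right r hs₀)
  have hrt : r ≤ t := by exact_mod_cast hr ▸ minTime_le_of_steersToOrigin ht
  obtain ⟨-, u, y, hu, hy, hyt⟩ := ht
  have hs : s ∈ Icc 0 t := ⟨hs₀.le, hsr.le.trans hrt⟩
  have hsδ' : ‖x₀ - x₀‖ + C * s < δ := by rwa [sub_self, norm_zero, zero_add]
  refine ⟨y s, ?_, hf.norm_sub_le hu hy hs hsδ' s ⟨hs₀.le, le_rfl⟩, ?_⟩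
  · refine (hy.minTime_le_sub hu hyt hs).trans ?_
    rw [hr]
    exact_mod_cast sub_le_iff_le_add.2 hts.le
  · simpa only [sub_self, norm_zero, zero_add] using hf.le_inner_sub (ζ := ζ) hu hy hs hsδ'

lemma exists_inner_sub_le (hf : UniformlyLipschitzNear f x₀ δ C K) {r : ℝ} (hr : 0 ≤ r)
    (hh : 0 ≤ minHamiltonian f x₀ ζ) (hζ : ζ ∈ proximalNormals (reachableSet f r) x₀) :
    ∃ κ ≥ 0, ∀ x s, 0 ≤ s → ‖x - x₀‖ + C * s < δ → minTime f x < (r + s : ℝ) →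
      inner ℝ ζ (x - x₀) ≤ κ * (‖x - x₀‖ + s) ^ 2 := by
  obtain ⟨-, σ, hσ₀, hσ⟩ := hζ
  refine ⟨σ * (1 + C) ^ 2 + K * ‖ζ‖ * (1 + C), by positivity, fun x s hs hδ hx => ?_⟩
  obtain ⟨t, hts, ht, u, z, hu, hz, hzt⟩ := exists_steersToOrigin_lt hx
  -- Follow the trajectory until the remaining time is at most `r`.
  obtain ⟨q, hq, hqs, hqr⟩ : ∃ q ∈ Icc 0 t, q ≤ s ∧ t - q ≤ r :=
    ⟨max (t - r) 0, ⟨le_max_right _ _, max_le (sub_le_self t hr) ht⟩,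
      max_le (by linarith) hs, by linarith [le_max_left (t - r) 0]⟩
  have hCq : C * q ≤ C * s := by gcongr
  have hδq : ‖x - x₀‖ + C * q < δ := by linarith
  have hzq : z q ∈ reachableSet f r :=
    (hz.minTime_le_sub hu hzt hq).trans (by exact_mod_cast hqr)
  have hle : ‖x - x₀‖ + C * s ≤ (1 + C) * (‖x - x₀‖ + s) := by
    linarith [mul_nonneg C.coe_nonneg (norm_nonneg (x - x₀))]
  have hdist : ‖z q - x₀‖ ≤ (1 + C) * (‖x - x₀‖ + s) := by
    linarith [norm_sub_le_norm_sub_add_norm_sub (z q) x x₀,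
      hf.norm_sub_le hu hz hq hδq q ⟨hq.1, le_rfl⟩]
  have hend : inner ℝ ζ (z q - x₀) ≤ σ * ((1 + C) * (‖x - x₀‖ + s)) ^ 2 :=
    (hσ _ hzq).trans (by gcongr)
  have hmove : -((‖x - x₀‖ + s) * (K * ‖ζ‖ * ((1 + C) * (‖x - x₀‖ + s)))) ≤
      inner ℝ ζ (z q - x) := by
    have hlower := hf.le_inner_sub (ζ := ζ) hu hz hq hδq
    have hdrift : q * (K * ‖ζ‖ * (‖x - x₀‖ + C * q)) ≤
        (‖x - x₀‖ + s) * (K * ‖ζ‖ * ((1 + C) * (‖x - x₀‖ + s))) := by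
      have hq₀ : 0 ≤ q := hq.1
      gcongr
      · linarith [norm_nonneg (x - x₀)]
      · linarith
    linarith [mul_nonneg hq.1 hh]
  calc inner ℝ ζ (x - x₀) = inner ℝ ζ (z q - x₀) - inner ℝ ζ (z q - x) := by
        rw [← inner_sub_right, sub_sub_sub_cancel_left]
    _ ≤ (σ * (1 + C) ^ 2 + K * ‖ζ‖ * (1 + C)) * (‖x - x₀‖ + s) ^ 2 := by
        linarith

lemma mem_horizonSubdifferential (hf : UniformlyLipschitzNear f x₀ δ C K) (hT : minTime f x₀ < ⊤)
    (hh : 0 ≤ minHamiltonian f x₀ ζ)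
    (hζ : ζ ∈ proximalNormals (reachableSet f (minTime f x₀)) x₀) :
    ζ ∈ horizonSubdifferential (minTime f) x₀ := by
  obtain ⟨r, hr⟩ : ∃ r : ℝ, minTime f x₀ = r := ⟨_, (coe_toReal_minTime hT).symm⟩
  have hr₀ : 0 ≤ r := by exact_mod_cast hr ▸ minTime_nonneg x₀
  rw [hr] at hζ
  obtain ⟨κ, hκ₀, hκ⟩ := hf.exists_inner_sub_le hr₀ hh hζ
  refine (mem_horizonSubdifferential_iff_eventually hr).2 ⟨κ * 5, ?_⟩
  have hnear : ∀ᶠ p : EuclideanSpace ℝ (Fin N) × ℝ in 𝓝 (x₀, r),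
      ‖p.1 - x₀‖ + C * (|p.2 - r| + ‖p.1 - x₀‖) < δ :=
    (by fun_prop : Continuous fun p : EuclideanSpace ℝ (Fin N) × ℝ =>
      ‖p.1 - x₀‖ + C * (|p.2 - r| + ‖p.1 - x₀‖)).continuousAt.eventually_lt_const
        (by simpa using hf.radius_pos)
  filter_upwards [hnear] with ⟨x, β⟩ hδ hβ
  rcases eq_or_ne x x₀ with rfl | hx
  · rw [sub_self, inner_zero_right]
    positivity
  have hxβ : minTime f x < (r + (|β - r| + ‖x - x₀‖) : ℝ) := by
    refine hβ.trans_lt (EReal.coe_lt_coe_iff.2 ?_)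
    linarith [le_abs_self (β - r), norm_pos_iff.2 (sub_ne_zero.2 hx)]
  calc inner ℝ ζ (x - x₀) ≤ κ * (‖x - x₀‖ + (|β - r| + ‖x - x₀‖)) ^ 2 :=
        hκ x _ (by positivity) hδ hxβ
    _ ≤ κ * (5 * (‖x - x₀‖ ^ 2 + |β - r| ^ 2)) := by
        gcongr
        linarith [sq_nonneg (‖x - x₀‖ - 2 * |β - r|)]
    _ = κ * 5 * (‖x - x₀‖ ^ 2 + (β - r) ^ 2) := by rw [sq_abs, mul_assoc]

end UniformlyLipschitzNear

lemma linearDynamics_eq_affineDynamics (A : Matrix (Fin N) (Fin N) ℝ)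
    (B : Matrix (Fin N) (Fin M) ℝ) :
    linearDynamics A B =
      affineDynamics (Matrix.toEuclideanCLM (𝕜 := ℝ) A) fun i _ => WithLp.toLp 2 (B.col i) := by
  funext x w
  ext j
  simp [linearDynamics, affineDynamics, Matrix.mulVec, dotProduct, mul_comm]

lemma locallyLipschitz_uncurry_affineDynamics
    {F : EuclideanSpace ℝ (Fin N) → EuclideanSpace ℝ (Fin N)}
    {g : Fin M → EuclideanSpace ℝ (Fin N) → EuclideanSpace ℝ (Fin N)}
    (hF : ContDiff ℝ 1 F) (hg : ∀ i, ContDiff ℝ 1 (g i)) :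
    LocallyLipschitz (Function.uncurry (affineDynamics F g)) := by
  refine ContDiff.locallyLipschitz (𝕂 := ℝ) ?_
  unfold Function.uncurry affineDynamics
  fun_prop

lemma locallyLipschitz_uncurry_linearDynamics (A : Matrix (Fin N) (Fin N) ℝ)
    (B : Matrix (Fin N) (Fin M) ℝ) :
    LocallyLipschitz (Function.uncurry (linearDynamics A B)) :=
  linearDynamics_eq_affineDynamics A B ▸ locallyLipschitz_uncurry_affineDynamics
    (ContinuousLinearMap.contDiff _) fun _ => contDiff_const

end Control

end MinTime

theorem proposition3p3_general {N M : ℕ}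
    {f : EuclideanSpace ℝ (Fin N) → (Fin M → ℝ) → EuclideanSpace ℝ (Fin N)}
    {x₀ ζ : EuclideanSpace ℝ (Fin N)} {δ : ℝ} {C K : ℝ≥0}
    (hf : MinTime.UniformlyLipschitzNear f x₀ δ C K) (hx₀ : x₀ ≠ 0)
    (hT : MinTime.minTime f x₀ < ⊤) :
    ζ ∈ MinTime.horizonSubdifferential (MinTime.minTime f) x₀ ↔
      MinTime.minHamiltonian f x₀ ζ = 0 ∧
        ζ ∈ MinTime.proximalNormals (MinTime.reachableSet f (MinTime.minTime f x₀)) x₀ := by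
  refine ⟨fun hζ => ?_, fun ⟨hh, hζ⟩ => hf.mem_horizonSubdifferential hT hh.ge hζ⟩
  have hnormal : ζ ∈ MinTime.proximalNormals
      (MinTime.reachableSet f (MinTime.minTime f x₀)) x₀ := by
    rw [← MinTime.coe_toReal_minTime hT]
    exact MinTime.mem_proximalNormals_sublevel_of_mem_horizonSubdifferential
      (MinTime.coe_toReal_minTime hT).symm hζ
  exact ⟨le_antisymm (hf.minHamiltonian_nonpos hx₀ hT hnormal) (hf.minHamiltonian_nonneg hT hζ),
    hnormal⟩

theorem proposition3p3 :
    -- linear systems in `ℝ ^ N`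
    (∀ (N M : ℕ) (A : Matrix (Fin N) (Fin N) ℝ) (B : Matrix (Fin N) (Fin M) ℝ)
      (xbar : EuclideanSpace ℝ (Fin N)) (D : Set (EuclideanSpace ℝ (Fin N)))
      (ζ : EuclideanSpace ℝ (Fin N)),
      xbar ≠ 0 →
      MinTime.minTime (MinTime.linearDynamics A B) xbar < ⊤ →
      D ∈ 𝓝 xbar →
      MinTime.HasLocallyPositiveReach
        (MinTime.epigraphOn D (MinTime.minTime (MinTime.linearDynamics A B))) →
      ζ ≠ 0 →
      (ζ ∈ MinTime.horizonSubdifferential (MinTime.minTime (MinTime.linearDynamics A B)) xbar ↔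
        MinTime.minHamiltonian (MinTime.linearDynamics A B) xbar ζ = 0 ∧
        ζ ∈ MinTime.proximalNormals
          (MinTime.reachableSet (MinTime.linearDynamics A B)
            (MinTime.minTime (MinTime.linearDynamics A B) xbar)) xbar)) ∧
    -- control-affine systems in the plane
    (∀ (M : ℕ) (F : EuclideanSpace ℝ (Fin 2) → EuclideanSpace ℝ (Fin 2))
      (g : Fin M → EuclideanSpace ℝ (Fin 2) → EuclideanSpace ℝ (Fin 2)) (L : ℝ≥0)
      (xbar : EuclideanSpace ℝ (Fin 2)) (D : Set (EuclideanSpace ℝ (Fin 2)))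
      (ζ : EuclideanSpace ℝ (Fin 2)),
      MinTime.IsC11 L F →
      (∀ i, MinTime.IsC11 L (g i)) →
      xbar ≠ 0 →
      MinTime.minTime (MinTime.affineDynamics F g) xbar < ⊤ →
      D ∈ 𝓝 xbar →
      MinTime.HasLocallyPositiveReach
        (MinTime.epigraphOn D (MinTime.minTime (MinTime.affineDynamics F g))) →
      ζ ≠ 0 →
      (ζ ∈ MinTime.horizonSubdifferential (MinTime.minTime (MinTime.affineDynamics F g)) xbar ↔
        MinTime.minHamiltonian (MinTime.affineDynamics F g) xbar ζ = 0 ∧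
        ζ ∈ MinTime.proximalNormals
          (MinTime.reachableSet (MinTime.affineDynamics F g)
            (MinTime.minTime (MinTime.affineDynamics F g) xbar)) xbar)) := by
  refine ⟨fun N M A B xbar D ζ hx hT _ _ _ => ?_, fun M F g L xbar D ζ hF hg hx hT _ _ _ => ?_⟩
  · obtain ⟨C, K, hf⟩ := MinTime.exists_uniformlyLipschitzNear
      (MinTime.locallyLipschitz_uncurry_linearDynamics A B) xbar one_pos
    exact proposition3p3_general hf hx hT
  · obtain ⟨C, K, hf⟩ := MinTime.exists_uniformlyLipschitzNear
      (MinTime.locallyLipschitz_uncurry_affineDynamics hF.1 fun i => (hg i).1) xbar one_pos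
    exact proposition3p3_general hf hx hT
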